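/- Let $G$ be a group that is a nontrivial amalgamated product $G = A *_C B$, that is, $A$ and $B$ are subgroups of $G$, $C$ is a subgroup of both $A$ and $B$, the canonical homomorphism to $G$ from the free product of $A$ and $B$ amalgamated along $C$ is an isomorphism, and $A \neq C \neq B$. Let $N$ be a normal subgroup of $G$. 1. If $N$ is finitely generated and $N \not\subseteq C$, then $NC$ has finite index in $G$; if moreover $N \cap C$ is finitely generated, then $N \cap A$ and $N \cap B$ are finitely generated. 2. Conversely, if $NC$ has finite index in $G$, then $N \not\subseteq C$; if moreover $N \cap A$ and $N \cap B$ are finitely generated, then $N$ is finitely generated. 3. If $NC$ has finite index in $G$, then $G/N$ is finite if and only if $C/(N \cap C)$ is finite. -/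

import Mathlib

/-- The pair of subgroups `A`, `B`, as a family indexed by `Bool`. -/
def subgroupPair {G : Type*} [Group G] (A B : Subgroup G) : Bool → Subgroup G
  | false => A
  | true => B

theorem le_subgroupPair {G : Type*} [Group G] {A B C : Subgroup G}
    (hA : C ≤ A) (hB : C ≤ B) : ∀ i, C ≤ subgroupPair A B i
  | false => hA
  | true => hB

/-- For a common subgroup `C` of two subgroups `A`, `B` of `G`, the abstract amalgamated product
of `A` and `B` along `C`: the pushout of the inclusions `C → A` and `C → B`. -/
abbrev AmalgamatedProduct {G : Type*} [Group G] {A B C : Subgroup G}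
    (hA : C ≤ A) (hB : C ≤ B) : Type _ :=
  Monoid.PushoutI fun i => Subgroup.inclusion (le_subgroupPair hA hB i)

/-- The canonical homomorphism from the amalgamated product of `A` and `B` along `C` to `G`,
which restricts to the inclusions of `A`, `B` and `C` in `G`. -/
def amalgamToGroup {G : Type*} [Group G] {A B C : Subgroup G}
    (hA : C ≤ A) (hB : C ≤ B) : AmalgamatedProduct hA hB →* G :=
  Monoid.PushoutI.lift (fun i => (subgroupPair A B i).subtype) C.subtype
    fun i => Subgroup.subtype_comp_inclusion (le_subgroupPair hA hB i)

/-- `G = A *_C B`: `C` is a common subgroup of the subgroups `A` and `B` of `G`, and the canonical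
homomorphism from the amalgamated product of `A` and `B` along `C` to `G` is an isomorphism. -/
structure IsAmalgamatedProduct {G : Type*} [Group G] (A B C : Subgroup G) : Prop where
  le_left : C ≤ A
  le_right : C ≤ B
  bijective : Function.Bijective (amalgamToGroup le_left le_right)

/-- `G = A *_C B` is a nontrivial amalgamated product: moreover `A ≠ C ≠ B`. -/
structure IsNontrivialAmalgamatedProduct {G : Type*} [Group G] (A B C : Subgroup G) : Prop
    extends IsAmalgamatedProduct A B C where
  left_ne : A ≠ C
  ne_right : C ≠ B

/-!
The argument is Bass–Serre theory without the tree. In the Bass–Serre tree of `G = A *_C B` the edges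
are the cosets `gC`, and two edges share an endpoint when they differ by right multiplication by an
element of `A` or of `B`. Removing the edge `C` cuts the tree in two; all that is used of the tree is
one of the halves, a set `U ⊆ G` (`IsHalfTree`). It exists by the universal property alone: the
homomorphism from `G` to the permutations of `G × Bool` in which `A` acts by right translation, and
`B` by right translation conjugated by the flip of the `Bool` over `C`, records in the `Bool` how often
a path crosses the edge `C` (`IsAmalgamatedProduct.exists_isHalfTree`).

*Finite index.* Let `N` be generated by a finite set `S`. Only finitely many edges separate `1` from
some `s ∈ S`, so if `NC` had infinite index, some translate of `U` would separate no two elements of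
`N`. Then a translate `Nx` lies in one half. An element of `A` or `B` outside `C` throws this half
into the opposite one, so, `N` being normal, another translate `Ny` lies in the opposite half. The
edges `nC` with `n ∈ N` all separate `y` from `x`; they are finitely many, linearly ordered, and
permuted monotonically by `N`, hence fixed, so `N ≤ C` (`IsHalfTree.le_of_separated`,
`IsHalfTree.finiteIndex_sup`).

*From `N` and `N ∩ C` to `N ∩ A`.* As `N` has finitely many orbits on `A / C`, with finitely generated
stabilizers, there is a map `A → N ∩ A` that is `N ∩ A`-equivariant modulo a finitely generated
subgroup. Extend it to `f : G → N ∩ A` by giving every edge the value of the edge at the vertex `A`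
through which it is reached. Along the translates by `N` of a fixed path, `f` changes only by finitely
many elements up to equivariance. If `N` is finitely generated, `f` is therefore constant on `N` modulo
a finitely generated subgroup of `N ∩ A`, which by equivariance is all of `N ∩ A`
(`IsHalfTree.fg_inf_left`). The group `N ∩ B` is handled by exchanging the two halves.

*From `N ∩ A` and `N ∩ B` to `N`.* This is the generation of a group acting on a connected graph with
finite quotient by vertex stabilizers and finitely many transition elements
(`Subgroup.fg_of_fg_inf`). The index of `C` is infinite because `ba` has no power in `C` for
`a ∈ A ∖ C` and `b ∈ B ∖ C`, and the last claim is multiplicativity of the index.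
-/

/-! ### The universal property of an amalgamated product -/

theorem amalgamToGroup_of {G : Type*} [Group G] {A B C : Subgroup G} (hA : C ≤ A) (hB : C ≤ B)
    (i : Bool) (x : subgroupPair A B i) :
    amalgamToGroup hA hB (Monoid.PushoutI.of
      (G := fun i => subgroupPair A B i) (φ := fun i => Subgroup.inclusion (le_subgroupPair hA hB i)) i x) = x :=
  Monoid.PushoutI.lift_of (G := fun i => subgroupPair A B i)
    (φ := fun i => Subgroup.inclusion (le_subgroupPair hA hB i)) _ _ _ x

theorem amalgamToGroup_base {G : Type*} [Group G] {A B C : Subgroup G} (hA : C ≤ A) (hB : C ≤ B)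
    (c : C) :
    amalgamToGroup hA hB (Monoid.PushoutI.base
      (fun i => Subgroup.inclusion (le_subgroupPair hA hB i)) c) = c :=
  Monoid.PushoutI.lift_base _ _ _ c

/-- Homomorphisms on `A` and `B` that agree on `C` extend to a homomorphism on `A *_C B`. -/
theorem IsAmalgamatedProduct.exists_hom {G K : Type*} [Group G] [Group K] {A B C : Subgroup G}
    (h : IsAmalgamatedProduct A B C) (f : A →* K) (g : B →* K)
    (hfg : ∀ c (hc : c ∈ C), f ⟨c, h.le_left hc⟩ = g ⟨c, h.le_right hc⟩) :
    ∃ φ : G →* K, (∀ a : A, φ a = f a) ∧ ∀ b : B, φ b = g b := by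
  let F : ∀ i, subgroupPair A B i →* K := fun i =>
    match i with
    | false => f
    | true => g
  let L : AmalgamatedProduct h.le_left h.le_right →* K :=
    Monoid.PushoutI.lift F (f.comp (Subgroup.inclusion h.le_left)) <| by
      rintro (_ | _)
      · rfl
      · ext c
        exact (hfg c.1 c.2).symm
  let e := MulEquiv.ofBijective _ h.bijective
  have key : ∀ (i : Bool) (x : subgroupPair A B i), L (e.symm (x : G)) = F i x := by
    intro i x
    have hx : e.symm (x : G) = Monoid.PushoutI.of (G := fun i => subgroupPair A B i)
        (φ := fun i => Subgroup.inclusion (le_subgroupPair h.le_left h.le_right i)) i x :=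
      e.symm_apply_eq.2 (amalgamToGroup_of h.le_left h.le_right i x).symm
    rw [hx]
    exact Monoid.PushoutI.lift_of (G := fun i => subgroupPair A B i)
      (φ := fun i => Subgroup.inclusion (le_subgroupPair h.le_left h.le_right i)) _ _ _ x
  exact ⟨L.comp e.symm.toMonoidHom, fun a => key false a, fun b => key true b⟩

theorem IsAmalgamatedProduct.sup_eq_top {G : Type*} [Group G] {A B C : Subgroup G}
    (h : IsAmalgamatedProduct A B C) : A ⊔ B = ⊤ := by
  rw [eq_top_iff]
  intro g _
  obtain ⟨x, rfl⟩ := h.bijective.2 g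
  induction x using Monoid.PushoutI.induction_on with
  | of i x =>
    rw [amalgamToGroup_of]
    cases i
    · exact Subgroup.mem_sup_left x.2
    · exact Subgroup.mem_sup_right x.2
  | base c =>
    rw [amalgamToGroup_base]
    exact Subgroup.mem_sup_left (h.le_left c.2)
  | mul x y hx hy =>
    rw [map_mul]
    exact mul_mem (hx trivial) (hy trivial)

/-! ### Half trees -/

/-- `U` is the set of `g` such that the edge `gC` of the Bass–Serre tree of `A *_C B` is `C` itself or
lies on the side of the vertex `A` when the edge `C` is removed. The axioms say that passing from an
edge to another one at a common vertex changes the side only at the vertex `B`, and that `C` is the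
only edge at the vertex `B` that belongs to `U`. -/
structure IsHalfTree {G : Type*} [Group G] (A B C : Subgroup G) (U : Set G) : Prop where
  le_left : C ≤ A
  le_right : C ≤ B
  sup_eq_top : A ⊔ B = ⊤
  mul_mem_iff : ∀ g, ∀ a ∈ A, g * a ∈ U ↔ g ∈ U
  mul_mem_iff_of_notMem : ∀ g ∉ B, ∀ b ∈ B, g * b ∈ U ↔ g ∈ U
  mem_iff : ∀ b ∈ B, b ∈ U ↔ b ∈ C

open Classical in
/-- The half tree comes from a homomorphism of `G` to the permutations of `G × Bool`, which exists by
the universal property: `A` acts by right translation and `B` by a conjugate of it. -/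
theorem IsAmalgamatedProduct.exists_isHalfTree {G : Type*} [Group G] {A B C : Subgroup G}
    (h : IsAmalgamatedProduct A B C) : ∃ U : Set G, IsHalfTree A B C U := by
  let ρ : G →* Equiv.Perm (G × Bool) :=
    { toFun := fun g => (Equiv.mulRight g⁻¹).prodCongr (Equiv.refl Bool)
      map_one' := by ext x <;> simp
      map_mul' := fun x y => by ext z <;> simp [mul_assoc] }
  have hρ : ∀ g x ε, ρ g (x, ε) = (x * g⁻¹, ε) := fun _ _ _ => rfl
  have hinv : Function.Involutive fun p : G × Bool => (p.1, xor p.2 (decide (p.1 ∈ C))) := by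
    rintro ⟨x, ε⟩
    simp
  -- The flip of the second component over `C`; it commutes with the right translations by `C`.
  let θ : Equiv.Perm (G × Bool) := hinv.toPerm
  have hθ : ∀ x ε, θ (x, ε) = (x, xor ε (decide (x ∈ C))) := fun _ _ => rfl
  have hθ' : ∀ x ε, θ⁻¹ (x, ε) = (x, xor ε (decide (x ∈ C))) := fun _ _ => rfl
  obtain ⟨φ, hφA, hφB⟩ := h.exists_hom (ρ.comp A.subtype)
    ((MulAut.conj θ).toMonoidHom.comp (ρ.comp B.subtype)) <| by
      intro c hc
      refine Equiv.ext fun ⟨x, ε⟩ => ?_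
      change ρ c (x, ε) = θ (ρ c (θ⁻¹ (x, ε)))
      rw [hθ', hρ, hρ, hθ]
      simp [Subgroup.mul_mem_cancel_right, hc]
  have hA : ∀ a ∈ A, ∀ x ε, φ a⁻¹ (x, ε) = (x * a, ε) := by
    intro a ha x ε
    rw [show φ a⁻¹ = ρ a⁻¹ from hφA ⟨a⁻¹, inv_mem ha⟩, hρ, inv_inv]
  have hB : ∀ b ∈ B, ∀ x ε, φ b⁻¹ (x, ε) =
      (x * b, xor (xor ε (decide (x ∈ C))) (decide (x * b ∈ C))) := by
    intro b hb x ε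
    rw [show φ b⁻¹ = θ * ρ b⁻¹ * θ⁻¹ from hφB ⟨b⁻¹, inv_mem hb⟩, Equiv.Perm.mul_apply,
      Equiv.Perm.mul_apply, hθ', hρ, hθ, inv_inv]
  -- The second component of `φ g⁻¹ (1, false)` is thus a function of `g` that is invariant under
  -- right multiplication by `A`, and changes under `B` exactly on entering or leaving `C`.
  have hfst : ∀ g x ε, (φ g⁻¹ (x, ε)).1 = x * g := by
    intro g
    have hg : g ∈ A ⊔ B := h.sup_eq_top ▸ Subgroup.mem_top g
    let S : Subgroup G :=
      { carrier := {g | ∀ p, (φ g p).1 = p.1 * g⁻¹}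
        one_mem' := fun p => by simp
        mul_mem' := fun {x y} hx hy p => by
          rw [map_mul, Equiv.Perm.mul_apply, hx, hy, mul_inv_rev, mul_assoc]
        inv_mem' := fun {x} hx p => by
          have := hx ((φ x)⁻¹ p)
          rw [← Equiv.Perm.mul_apply, mul_inv_cancel, Equiv.Perm.one_apply] at this
          rw [map_inv, this, mul_inv_cancel_right] }
    have hS : A ⊔ B ≤ S := by
      refine sup_le (fun a ha => ?_) fun b hb => ?_
      · rintro ⟨x, ε⟩
        have := hA a⁻¹ (inv_mem ha) x ε
        rw [inv_inv] at this
        rw [this]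
      · rintro ⟨x, ε⟩
        have := hB b⁻¹ (inv_mem hb) x ε
        rw [inv_inv] at this
        rw [this]
    intro x ε
    simpa using hS (inv_mem hg) (x, ε)
  have hφ : ∀ g, φ g⁻¹ (1, false) = (g, (φ g⁻¹ (1, false)).2) := fun g =>
    Prod.ext (by rw [hfst, one_mul]) rfl
  refine ⟨{g | (φ g⁻¹ (1, false)).2 = false}, h.le_left, h.le_right, h.sup_eq_top,
    fun g a ha => ?_, fun g hg b hb => ?_, fun b hb => ?_⟩
  · rw [Set.mem_ofPred_eq, Set.mem_ofPred_eq, mul_inv_rev, map_mul, Equiv.Perm.mul_apply, hφ g,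
      hA a ha]
  · have h₁ : g ∉ C := fun hc => hg (h.le_right hc)
    have h₂ : g * b ∉ C := fun hc => hg ((Subgroup.mul_mem_cancel_right _ hb).1 (h.le_right hc))
    rw [Set.mem_ofPred_eq, Set.mem_ofPred_eq, mul_inv_rev, map_mul, Equiv.Perm.mul_apply, hφ g,
      hB b hb]
    simp [h₁, h₂]
  · rw [Set.mem_ofPred_eq, hB b hb]
    simp [one_mem]

namespace IsHalfTree

variable {G : Type*} [Group G] {A B C : Subgroup G} {U : Set G}

/-- Induction along paths in the Bass–Serre tree that start at the edge `C`. -/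
theorem induction (h : IsHalfTree A B C U) {p : G → Prop} (one : p 1)
    (mul_left : ∀ g, ∀ a ∈ A, p g → p (g * a)) (mul_right : ∀ g, ∀ b ∈ B, p g → p (g * b))
    (g : G) : p g := by
  have hg : g ∈ Subgroup.closure ((A : Set G) ∪ B) := by
    rw [← Subgroup.sup_eq_closure, h.sup_eq_top]
    trivial
  induction hg using Subgroup.closure_induction_right with
  | one => exact one
  | mul_right x _ y hy hx =>
    exact hy.elim (fun hy => mul_left _ _ hy hx) fun hy => mul_right _ _ hy hx
  | mul_inv_cancel x _ y hy hx =>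
    exact hy.elim (fun hy => mul_left _ _ (inv_mem hy) hx) fun hy => mul_right _ _ (inv_mem hy) hx

theorem mem_of_mem_left (h : IsHalfTree A B C U) {a : G} (ha : a ∈ A) : a ∈ U := by
  rw [← one_mul a, h.mul_mem_iff 1 a ha, h.mem_iff 1 (one_mem _)]
  exact one_mem C

/-- The other half tree, with the roles of `A` and `B` exchanged; the edge `C` belongs to both. -/
theorem compl (h : IsHalfTree A B C U) : IsHalfTree B A C (Uᶜ ∪ C) where
  le_left := h.le_right
  le_right := h.le_left
  sup_eq_top := by rw [sup_comm, h.sup_eq_top]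
  mul_mem_iff g b hb := by
    by_cases hg : g ∈ B
    · have key : ∀ x ∈ B, x ∈ Uᶜ ∪ (C : Set G) := fun x hx => by
        simpa [h.mem_iff x hx] using (Classical.em (x ∈ C)).symm
      exact iff_of_true (key _ (mul_mem hg hb)) (key _ hg)
    · have h₁ : g ∉ C := fun hc => hg (h.le_right hc)
      have h₂ : g * b ∉ C := fun hc =>
        hg ((Subgroup.mul_mem_cancel_right _ hb).1 (h.le_right hc))
      simp [h₁, h₂, h.mul_mem_iff_of_notMem g hg b hb]
  mul_mem_iff_of_notMem g hg a ha := by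
    have h₁ : g ∉ C := fun hc => hg (h.le_left hc)
    have h₂ : g * a ∉ C := fun hc => hg ((Subgroup.mul_mem_cancel_right _ ha).1 (h.le_left hc))
    simp [h₁, h₂, h.mul_mem_iff g a ha]
  mem_iff a ha := by simp [h.mem_of_mem_left ha]

/-- If the edge `nC` is not in the half tree `U`, then it does not separate any two edges of `U`. -/
theorem inv_mul_mem_iff (h : IsHalfTree A B C U) {n g : G} (hn : n ∉ U) (hg : g ∈ U) :
    n⁻¹ * g ∈ U ↔ n⁻¹ ∈ U := by
  revert hg
  induction g using h.induction with
  | one => simp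
  | mul_left g a ha ih =>
    rw [h.mul_mem_iff g a ha, ← mul_assoc, h.mul_mem_iff _ a ha]
    exact ih
  | mul_right g b hb ih =>
    intro hgb
    by_cases hgB : g ∈ B
    · have hc := (h.mem_iff _ (mul_mem hgB hb)).1 hgb
      exact h.mul_mem_iff _ _ (h.le_left hc)
    · rw [h.mul_mem_iff_of_notMem g hgB b hb] at hgb
      rw [← mul_assoc, h.mul_mem_iff_of_notMem _ _ b hb]
      · exact ih hgb
      -- The edge `nC` could be crossed only at the vertex `gB`, and then it would lie in `U`.
      · intro hB
        apply hn
        have := (h.mul_mem_iff_of_notMem g hgB _ (inv_mem hB)).2 hgb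
        simpa using this

theorem mul_notMem (h : IsHalfTree A B C U) {b g : G} (hb : b ∈ B) (hbC : b ∉ C) (hg : g ∈ U) :
    b * g ∉ U := by
  have h₁ : b⁻¹ ∉ U := by rwa [h.mem_iff _ (inv_mem hb), inv_mem_iff]
  have := h.inv_mul_mem_iff h₁ hg
  rw [inv_inv] at this
  rwa [this, h.mem_iff _ hb]

theorem mul_mem_of_notMem (h : IsHalfTree A B C U) {a g : G} (ha : a ∈ A) (haC : a ∉ C)
    (hg : g ∉ U) : a * g ∈ U := by
  have := h.compl.mul_notMem ha haC (Or.inl hg)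
  simp only [Set.mem_union, not_or, Set.mem_compl_iff, not_not] at this
  exact this.1

theorem not_finiteIndex (h : IsHalfTree A B C U) (hA : A ≠ C) (hB : C ≠ B) :
    ¬ C.FiniteIndex := by
  intro hC
  obtain ⟨a, ha, haC⟩ := SetLike.exists_of_lt (lt_of_le_of_ne h.le_left hA.symm)
  obtain ⟨b, hb, hbC⟩ := SetLike.exists_of_lt (lt_of_le_of_ne h.le_right hB)
  obtain ⟨k, hk, -, hkC⟩ := Subgroup.exists_pow_mem_of_index_ne_zero hC.index_ne_zero (b * a)
  have key : ∀ k, (b * a) ^ (k + 1) ∉ U := by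
    intro k
    induction k with
    | zero => simpa using h.mul_notMem hb hbC (h.mem_of_mem_left ha)
    | succ k ih =>
      rw [pow_succ', mul_assoc]
      exact h.mul_notMem hb hbC (h.mul_mem_of_notMem ha haC ih)
  obtain ⟨k, rfl⟩ := Nat.exists_eq_succ_of_ne_zero hk.ne'
  exact key k (h.mem_of_mem_left (h.le_left hkC))

/-- Only finitely many edges `gC` separate the edge `C` from the edge `wC`. -/
theorem finite_separating (h : IsHalfTree A B C U) (w : G) :
    (((↑) : G → G ⧸ C) '' {g | ¬(g⁻¹ ∈ U ↔ g⁻¹ * w ∈ U)}).Finite := by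
  have hmul : ∀ w w', (((↑) : G → G ⧸ C) '' {g | ¬(g⁻¹ ∈ U ↔ g⁻¹ * w ∈ U)}).Finite →
      (((↑) : G → G ⧸ C) '' {g | ¬(g⁻¹ ∈ U ↔ g⁻¹ * w' ∈ U)}).Finite →
      (((↑) : G → G ⧸ C) '' {g | ¬(g⁻¹ ∈ U ↔ g⁻¹ * (w * w') ∈ U)}).Finite := by
    intro w w' hw hw'
    refine (hw.union (hw'.image (w • ·))).subset ?_
    rintro _ ⟨g, hg, rfl⟩
    by_cases hgw : g⁻¹ ∈ U ↔ g⁻¹ * w ∈ U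
    · refine Or.inr ⟨_, ⟨w⁻¹ * g, ?_, rfl⟩, ?_⟩
      · rw [Set.mem_ofPred_eq, hgw] at hg
        simpa [mul_assoc] using hg
      · change ((w * (w⁻¹ * g) : G) : G ⧸ C) = g
        rw [mul_inv_cancel_left]
    · exact Or.inl ⟨g, hgw, rfl⟩
  induction w using h.induction with
  | one => simp
  | mul_left w a ha ih =>
    refine hmul w a ih ?_
    simp [h.mul_mem_iff _ a ha]
  | mul_right w b hb ih =>
    refine hmul w b ih ?_
    refine (Set.toFinite {((1 : G) : G ⧸ C), (b : G ⧸ C)}).subset ?_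
    rintro _ ⟨g, hg, rfl⟩
    have hgB : g⁻¹ ∈ B := by
      by_contra hgB
      exact hg (h.mul_mem_iff_of_notMem _ hgB b hb).symm
    rw [Set.mem_ofPred_eq, h.mem_iff _ hgB, h.mem_iff _ (mul_mem hgB hb)] at hg
    by_cases hgC : g⁻¹ ∈ C
    · left
      rw [QuotientGroup.eq]
      simpa using hgC
    · right
      rw [Set.mem_singleton_iff, QuotientGroup.eq]
      tauto

/-- If `n ∈ N` were outside `U`, then `n⁻¹` would map `U` into itself, because the edge `nC` has `x` on
the same side as `U`; this is impossible if a power of `n` fixes the edge `C`. -/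
theorem subset_of_orbit (h : IsHalfTree A B C U) {N : Subgroup G} {x : G}
    (hx : ∀ n ∈ N, n * x ∈ U) (hpow : ∀ n ∈ N, ∃ k > 0, n ^ k ∈ C) : ∀ n ∈ N, n ∈ U := by
  intro n hn
  by_contra hnU
  have hmaps : ∀ g ∈ U, n⁻¹ * g ∈ U := by
    intro g hg
    rw [h.inv_mul_mem_iff hnU hg]
    have h₁ := hx 1 (one_mem _)
    rw [one_mul] at h₁
    exact (h.inv_mul_mem_iff hnU h₁).1 (hx _ (inv_mem hn))
  have hmaps' : ∀ k : ℕ, ∀ g ∈ U, n⁻¹ ^ k * g ∈ U := by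
    intro k
    induction k with
    | zero => simp
    | succ k ih =>
      intro g hg
      rw [pow_succ, mul_assoc]
      exact ih _ (hmaps g hg)
  obtain ⟨k, hk, hkC⟩ := hpow n hn
  obtain ⟨k, rfl⟩ := Nat.exists_eq_succ_of_ne_zero hk.ne'
  apply hnU
  have := hmaps' k _ (h.mem_of_mem_left (h.le_left hkC))
  rw [Nat.succ_eq_add_one, pow_succ] at this
  simpa using this

/-- If the edge `C` separates two orbits of `N`, then `N` fixes it. -/
theorem le_of_separated (h : IsHalfTree A B C U) {N : Subgroup G} {x y : G}
    (hx : ∀ n ∈ N, n * x ∈ U) (hy : ∀ n ∈ N, n * y ∉ U) : N ≤ C := by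
  -- All edges `n ^ k C` separate `y` from `x`, so two of them coincide.
  have hpow : ∀ n ∈ N, ∃ k > 0, n ^ k ∈ C := by
    intro n hn
    obtain ⟨i, j, hij, heq⟩ := (h.finite_separating (y⁻¹ * x)).exists_lt_map_eq_of_forall_mem
      (f := fun k : ℕ => ((y⁻¹ * n ^ k : G) : G ⧸ C)) fun k => by
        refine ⟨_, ?_, rfl⟩
        have h₁ := hx _ (inv_mem (pow_mem hn k))
        have h₂ := hy _ (inv_mem (pow_mem hn k))
        simp only [Set.mem_ofPred_eq, mul_inv_rev, inv_inv, mul_assoc, mul_inv_cancel_left]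
        tauto
    rw [QuotientGroup.eq] at heq
    refine ⟨j - i, Nat.sub_pos_of_lt hij, ?_⟩
    obtain ⟨d, rfl⟩ := Nat.exists_eq_add_of_le hij.le
    simpa [pow_add, mul_assoc] using heq
  intro n hn
  have h₁ := h.subset_of_orbit hx hpow n hn
  have h₂ := h.compl.subset_of_orbit (fun n hn => Or.inl (hy n hn)) hpow n hn
  exact h₂.resolve_left fun h₂ => h₂ h₁

/-- If the edge `x⁻¹C` separates no two edges `nC` with `n ∈ N`, then `N ≤ C`. -/
theorem le_of_one_side (h : IsHalfTree A B C U) (hA : A ≠ C) (hB : C ≠ B) {N : Subgroup G}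
    [N.Normal] {x : G} (hx : ∀ n ∈ N, x * n ∈ U ↔ x ∈ U) : N ≤ C := by
  obtain ⟨a, ha, haC⟩ := SetLike.exists_of_lt (lt_of_le_of_ne h.le_left hA.symm)
  obtain ⟨b, hb, hbC⟩ := SetLike.exists_of_lt (lt_of_le_of_ne h.le_right hB)
  have hx' : ∀ y, ∀ n ∈ N, ∃ m ∈ N, n * (y * x) = y * (x * m) := fun y n hn =>
    ⟨(y * x)⁻¹ * n * (y * x), by
      simpa using ‹N.Normal›.conj_mem n hn (y * x)⁻¹, by group⟩
  have hx1 : ∀ n ∈ N, ∃ m ∈ N, n * x = x * m := by simpa using hx' 1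
  by_cases hxU : x ∈ U
  · refine h.le_of_separated (x := x) (y := b * x) (fun n hn => ?_) fun n hn => ?_
    · obtain ⟨m, hm, e⟩ := hx1 n hn
      rw [e, hx m hm]
      exact hxU
    · obtain ⟨m, hm, e⟩ := hx' b n hn
      rw [e]
      exact h.mul_notMem hb hbC ((hx m hm).2 hxU)
  · refine h.le_of_separated (x := a * x) (y := x) (fun n hn => ?_) fun n hn => ?_
    · obtain ⟨m, hm, e⟩ := hx' a n hn
      rw [e]
      exact h.mul_mem_of_notMem ha haC fun hm' => hxU ((hx m hm).1 hm')
    · obtain ⟨m, hm, e⟩ := hx1 n hn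
      rwa [e, hx m hm]

/-- Every edge `gC` is a translate by `N` of one of the finitely many edges that separate `1` from a
generator of `N`. -/
theorem finiteIndex_sup (h : IsHalfTree A B C U) (hA : A ≠ C) (hB : C ≠ B) {N : Subgroup G}
    [N.Normal] (hN : N.FG) (hNC : ¬ N ≤ C) : (N ⊔ C).FiniteIndex := by
  obtain ⟨S, rfl⟩ := hN
  set N := Subgroup.closure (S : Set G)
  let E : Set (G ⧸ C) :=
    ⋃ s ∈ S, ((↑) : G → G ⧸ C) '' {g | ¬(g⁻¹ ∈ U ↔ g⁻¹ * s ∈ U)}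
  have hE : E.Finite := S.finite_toSet.biUnion fun s _ => h.finite_separating s
  -- It suffices that the finite set `E` of edges meets every coset of `NC`.
  let π : G ⧸ C → G ⧸ (N ⊔ C) := Quotient.map' id fun x y => by
    rw [QuotientGroup.leftRel_apply, QuotientGroup.leftRel_apply]
    exact fun h => Subgroup.mem_sup_right h
  have hπ : π '' E = Set.univ := by
    rw [Set.eq_univ_iff_forall]
    intro q
    obtain ⟨g, rfl⟩ := QuotientGroup.mk_surjective q
    by_contra hg
    refine hNC (h.le_of_one_side hA hB (x := g⁻¹) fun n hn => ?_)
    have key : ∀ m ∈ N, ∀ s ∈ S, (g⁻¹ * m ∈ U ↔ g⁻¹ * m * s ∈ U) := by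
      intro m hm s hs
      by_contra hms
      refine hg ⟨((m⁻¹ * g : G) : G ⧸ C), ?_, ?_⟩
      · refine Set.mem_biUnion hs ⟨_, ?_, rfl⟩
        simpa using hms
      · change ((m⁻¹ * g : G) : G ⧸ (N ⊔ C)) = g
        rw [QuotientGroup.eq]
        refine Subgroup.mem_sup_left ?_
        have := ‹N.Normal›.conj_mem m hm g⁻¹
        simpa [mul_assoc] using this
    induction hn using Subgroup.closure_induction_right with
    | one => simp
    | mul_right m hm s hs ih => 
      rw [← mul_assoc]
      exact (key m hm s hs).symm.trans ih
    | mul_inv_cancel m hm s hs ih =>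
      have := key (m * s⁻¹) (mul_mem hm (inv_mem (Subgroup.subset_closure hs))) s hs
      rw [mul_assoc, mul_assoc, inv_mul_cancel, mul_one] at this
      exact this.trans ih
  have : Finite (G ⧸ (N ⊔ C)) := Set.finite_univ_iff.1 (hπ ▸ hE.image π)
  exact Subgroup.finiteIndex_of_finite_quotient

end IsHalfTree

/-! ### Finite generation of the intersections with the factors -/

section

variable {G : Type*} [Group G]

theorem Subgroup.FG.map_hom {H : Type*} [Group H] {P : Subgroup G} (hP : P.FG) (f : G →* H) :
    (P.map f).FG := by
  classical
  obtain ⟨S, rfl⟩ := hP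
  exact ⟨S.image f, by rw [MonoidHom.map_closure, Finset.coe_image]⟩

theorem Subgroup.fg_zpowers (g : G) : (Subgroup.zpowers g).FG :=
  ⟨{g}, by rw [Finset.coe_singleton, Subgroup.zpowers_eq_closure]⟩

/-- A map from `A` to `N ⊓ A` which, modulo a finitely generated subgroup `P`, is invariant under right
multiplication by `C` and equivariant under left multiplication by `N ⊓ A`. -/
theorem exists_equivariant_map {A C N : Subgroup G} [N.Normal] (hCA : C ≤ A)
    [(N ⊔ C).FiniteIndex] (hNC : (N ⊓ C).FG) :
    ∃ (t : G → G) (P : Subgroup G), P.FG ∧ P ≤ N ⊓ A ∧ (∀ a ∈ A, t a ∈ N ⊓ A) ∧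
      ∀ a ∈ A, ∀ m ∈ N ⊓ A, ∀ c ∈ C, (m * t a)⁻¹ * t (m * a * c) ∈ P := by
  classical
  -- Choose a representative `r a` of each class in `A / (NC ∩ A)` and write `a = n * r a * c`; the
  -- element `n ∈ N ⊓ A` is unique up to the stabilizer of the edge `(r a)C`.
  let r : A → A := fun a => (a : A ⧸ (N ⊔ C).subgroupOf A).out
  have hr : ∀ a : A, ∃ n ∈ N ⊓ A, ∃ c ∈ C, (a : G) = n * r a * c := by
    intro a
    have h₁ : (r a)⁻¹ * a ∈ (N ⊔ C).subgroupOf A := by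
      rw [← QuotientGroup.eq]
      exact Quotient.out_eq _
    obtain ⟨y, hy, z, hz, e⟩ := Subgroup.mem_sup_of_normal_left.1 (Subgroup.mem_subgroupOf.1 h₁)
    have e' : (a : G) = (r a * y * (r a : G)⁻¹) * r a * z := by
      simp only [Subgroup.coe_mul, Subgroup.coe_inv] at e
      rw [inv_mul_cancel_right, mul_assoc, e, mul_inv_cancel_left]
    refine ⟨_, ⟨‹N.Normal›.conj_mem y hy (r a), ?_⟩, z, hz, e'⟩
    have : (r a * y * (r a : G)⁻¹) = a * z⁻¹ * (r a : G)⁻¹ := by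
      rw [eq_mul_inv_iff_mul_eq, eq_mul_inv_iff_mul_eq, e'.symm]
    rw [this]
    exact A.mul_mem (A.mul_mem a.2 (A.inv_mem (hCA hz))) (A.inv_mem (r a).2)
  choose τ hτ κ hκ hτκ using hr
  let P : Subgroup G := ⨆ q : A ⧸ (N ⊔ C).subgroupOf A,
    (N ⊓ C).map (MulAut.conj (q.out : G)).toMonoidHom
  refine ⟨fun g => if h : g ∈ A then τ ⟨g, h⟩ else 1, P, ?_, ?_, ?_, ?_⟩
  · exact Subgroup.FG.iSup _ fun q => hNC.map_hom _
  · refine iSup_le fun q => ?_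
    rintro _ ⟨x, hx, rfl⟩
    exact ⟨‹N.Normal›.conj_mem x hx.1 _,
      A.mul_mem (A.mul_mem q.out.2 (hCA hx.2)) (A.inv_mem q.out.2)⟩
  · intro a ha
    simpa [ha] using hτ ⟨a, ha⟩
  · intro a ha m hm c hc
    have hmac : m * a * c ∈ A := mul_mem (mul_mem hm.2 ha) (hCA hc)
    have hreq : r ⟨m * a * c, hmac⟩ = r ⟨a, ha⟩ := by
      refine congrArg Quotient.out (QuotientGroup.eq.2 ?_).symm
      rw [Subgroup.mem_subgroupOf]
      change a⁻¹ * (m * a * c) ∈ N ⊔ C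
      rw [show a⁻¹ * (m * a * c) = a⁻¹ * m * a⁻¹⁻¹ * c by group]
      exact mul_mem (Subgroup.mem_sup_left (‹N.Normal›.conj_mem m hm.1 a⁻¹))
        (Subgroup.mem_sup_right hc)
    simp only [ha, hmac, dite_true]
    have e₁ := hτκ ⟨a, ha⟩
    have e₂ := hτκ ⟨m * a * c, hmac⟩
    rw [hreq] at e₂
    have h₁ := hτ ⟨a, ha⟩
    have h₂ := hτ ⟨m * a * c, hmac⟩
    have h₃ := hκ ⟨a, ha⟩
    have h₄ := hκ ⟨m * a * c, hmac⟩
    simp only at e₁ e₂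
    set ρ : G := (r ⟨a, ha⟩ : G) with hρ
    set n₁ := τ ⟨a, ha⟩
    set n₂ := τ ⟨m * a * c, hmac⟩
    set c₁ := κ ⟨a, ha⟩
    set c₂ := κ ⟨m * a * c, hmac⟩
    have e : (m * n₁)⁻¹ * n₂ = ρ * (c₁ * c * c₂⁻¹) * ρ⁻¹ := by
      have : n₂ = m * a * c * c₂⁻¹ * ρ⁻¹ := by
        rw [e₂]
        group
      rw [this, e₁]
      group
    have hN : c₁ * c * c₂⁻¹ ∈ N := by
      have h : (m * n₁)⁻¹ * n₂ ∈ N := mul_mem (inv_mem (mul_mem hm.1 h₁.1)) h₂.1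
      rw [e] at h
      have := ‹N.Normal›.conj_mem _ h ρ⁻¹
      rwa [show ρ⁻¹ * (ρ * (c₁ * c * c₂⁻¹) * ρ⁻¹) * ρ⁻¹⁻¹ = c₁ * c * c₂⁻¹ by group] at this
    rw [e]
    refine Subgroup.mem_iSup_of_mem (((⟨a, ha⟩ : A)) : A ⧸ (N ⊔ C).subgroupOf A) ?_
    exact Subgroup.mem_map_of_mem _
      (Subgroup.mem_inf.2 ⟨hN, mul_mem (mul_mem h₃ hc) (inv_mem h₄)⟩)

/-- If `N` and `N ⊓ C` are finitely generated and `NC` has finite index, then `N ⊓ A` is finitely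
generated. -/
theorem IsHalfTree.fg_inf_left {A B C : Subgroup G} {U : Set G} (h : IsHalfTree A B C U)
    {N : Subgroup G} [N.Normal] (hN : N.FG) [(N ⊔ C).FiniteIndex] (hNC : (N ⊓ C).FG) :
    (N ⊓ A).FG := by
  obtain ⟨t, P₀, hP₀, hP₀A, htA, ht⟩ := exists_equivariant_map h.le_left hNC
  have hV := h.compl
  set V : Set G := Uᶜ ∪ C
  have hone : (1 : G) ∈ V := (hV.mem_iff 1 (one_mem _)).2 (one_mem _)
  -- Every edge `x` lies in the branch at the vertex `A` of an edge `aC`, unique by `hV.mul_notMem`;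
  -- its value `f x` is the value of `t` at that edge.
  have hα : ∀ x, ∃ a ∈ A, a⁻¹ * x ∈ V := by
    intro x
    induction x using h.induction with
    | one => exact ⟨1, one_mem _, by simpa using hone⟩
    | mul_left x a ha ih =>
      obtain ⟨a₁, ha₁, hx⟩ := ih
      by_cases hxA : a₁⁻¹ * x ∈ A
      · refine ⟨x * a, mul_mem ?_ ha, by simpa using hone⟩
        simpa using mul_mem ha₁ hxA
      · refine ⟨a₁, ha₁, ?_⟩
        rwa [← mul_assoc, hV.mul_mem_iff_of_notMem _ hxA a ha]
    | mul_right x b hb ih =>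
      obtain ⟨a₁, ha₁, hx⟩ := ih
      refine ⟨a₁, ha₁, ?_⟩
      rwa [← mul_assoc, hV.mul_mem_iff _ b hb]
  choose α hαA hαV using hα
  let f : G → G := fun x => t (α x)
  have hft : ∀ a ∈ A, ∀ x, a⁻¹ * x ∈ V → (t a)⁻¹ * f x ∈ P₀ := by
    intro a ha x hx
    have hc : a⁻¹ * α x ∈ C := by
      by_contra hc
      have := hV.mul_notMem (mul_mem (inv_mem ha) (hαA x)) hc (hαV x)
      rw [mul_assoc, mul_inv_cancel_left] at this
      exact this hx
    simpa using ht a ha 1 (one_mem _) _ hc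
  have hff : ∀ a ∈ A, ∀ x y, a⁻¹ * x ∈ V → a⁻¹ * y ∈ V → (f x)⁻¹ * f y ∈ P₀ := by
    intro a ha x y hx hy
    have := mul_mem (inv_mem (hft a ha x hx)) (hft a ha y hy)
    simpa [mul_assoc] using this
  have hfm : ∀ a ∈ A, ∀ m ∈ N ⊓ A, (m * t a)⁻¹ * f (m * a) ∈ P₀ := by
    intro a ha m hm
    have h₁ := ht a ha m hm 1 (one_mem _)
    have h₂ := hft (m * a) (mul_mem hm.2 ha) (m * a) (by simpa using hone)
    rw [mul_one] at h₁
    simpa [mul_assoc] using mul_mem h₁ h₂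
  -- Along a path from `g` to `g * w`, translated by `n ∈ N`, the value of `f` changes only on passing
  -- through the vertex `A`; by equivariance of `t`, the change modulo `P₀` does not depend on `n`.
  have key : ∀ w g, ∃ P : Subgroup G, P.FG ∧ P₀ ≤ P ∧ P ≤ N ⊓ A ∧
      ∀ n ∈ N, (f (n * g))⁻¹ * f (n * g * w) ∈ P := by
    intro w g
    induction w using h.induction with
    | one => exact ⟨P₀, hP₀, le_rfl, hP₀A, by simp [one_mem]⟩
    | mul_right w b hb ih =>
      obtain ⟨P, hP, hP₀P, hPA, hPf⟩ := ih
      refine ⟨P, hP, hP₀P, hPA, fun n hn => ?_⟩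
      have := hff _ (hαA (n * g * w)) (n * g * w) (n * g * w * b) (hαV _) (by
        rw [← mul_assoc, hV.mul_mem_iff _ b hb]
        exact hαV _)
      simpa [mul_assoc] using mul_mem (hPf n hn) (hP₀P this)
    | mul_left w a ha ih =>
      obtain ⟨P, hP, hP₀P, hPA, hPf⟩ := ih
      have hout : ∀ n, n * g * w ∉ A → (f (n * g * w))⁻¹ * f (n * g * w * a) ∈ P := by
        intro n hn
        refine hP₀P (hff _ (hαA (n * g * w)) (n * g * w) (n * g * w * a) (hαV _) ?_)
        rw [← mul_assoc, hV.mul_mem_iff_of_notMem _ _ a ha]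
        · exact hαV _
        · rwa [Subgroup.mul_mem_cancel_left _ (inv_mem (hαA _))]
      by_cases hex : ∃ n₀ ∈ N, n₀ * g * w ∈ A
      · obtain ⟨n₀, hn₀, hx₀⟩ := hex
        set x₀ := n₀ * g * w with hx₀_def
        have hd : (t x₀)⁻¹ * t (x₀ * a) ∈ N ⊓ A :=
          mul_mem (inv_mem (htA _ hx₀)) (htA _ (mul_mem hx₀ ha))
        refine ⟨P ⊔ Subgroup.zpowers ((t x₀)⁻¹ * t (x₀ * a)), ?_, hP₀P.trans le_sup_left,
          sup_le hPA ?_, fun n hn => ?_⟩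
        · exact hP.sup (Subgroup.fg_zpowers _)
        · rwa [Subgroup.zpowers_le]
        · have hstep : (f (n * g * w))⁻¹ * f (n * g * w * a) ∈
              P ⊔ Subgroup.zpowers ((t x₀)⁻¹ * t (x₀ * a)) := by
            by_cases hx : n * g * w ∈ A
            · have hm : n * n₀⁻¹ * x₀ = n * g * w := by
                rw [hx₀_def]
                group
              have hmA : n * n₀⁻¹ ∈ N ⊓ A :=
                ⟨N.mul_mem hn (N.inv_mem hn₀), by
                  rwa [← hm, Subgroup.mul_mem_cancel_right _ hx₀] at hx⟩
              have h₁ := hfm x₀ hx₀ _ hmA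
              have h₂ := hfm (x₀ * a) (mul_mem hx₀ ha) _ hmA
              rw [← mul_assoc, hm] at h₂
              rw [hm] at h₁
              have h₃ := mul_mem (mul_mem
                (Subgroup.mem_sup_left (T := Subgroup.zpowers ((t x₀)⁻¹ * t (x₀ * a)))
                  (hP₀P (inv_mem h₁)))
                (Subgroup.mem_sup_right (Subgroup.mem_zpowers ((t x₀)⁻¹ * t (x₀ * a)))))
                (Subgroup.mem_sup_left (hP₀P h₂))
              convert h₃ using 1
              group
            · exact Subgroup.mem_sup_left (hout n hx)
          simpa [mul_assoc] using mul_mem (Subgroup.mem_sup_left (hPf n hn)) hstep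
      · push Not at hex
        refine ⟨P, hP, hP₀P, hPA, fun n hn => ?_⟩
        simpa [mul_assoc] using mul_mem (hPf n hn) (hout n (hex n hn))
  -- The changes along the paths from `1` to the generators of `N` generate, with `P₀`, the group `Q`.
  choose P hP hP₀P hPA hPf using fun w => key w 1
  obtain ⟨S, hS⟩ := hN
  let Q : Subgroup G := P 1 ⊔ ⨆ s : S, P s
  have hQ : Q.FG := (hP 1).sup (Subgroup.FG.iSup _ fun s => hP s)
  have hQA : Q ≤ N ⊓ A := sup_le (hPA 1) (iSup_le fun s => hPA s)
  have hstep : ∀ n ∈ N, ∀ s ∈ S, (f n)⁻¹ * f (n * s) ∈ Q := by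
    intro n hn s hs
    have := hPf s n hn
    rw [mul_one] at this
    exact Subgroup.mem_sup_right (Subgroup.mem_iSup_of_mem (⟨s, hs⟩ : S) this)
  have hconst : ∀ n ∈ N, (f 1)⁻¹ * f n ∈ Q := by
    intro n hn
    rw [← hS] at hn
    induction hn using Subgroup.closure_induction_right with
    | one => simp [one_mem]
    | mul_right m hm s hs ih =>
      have := hstep m (hS ▸ hm) s hs
      simpa [mul_assoc] using mul_mem ih this
    | mul_inv_cancel m hm s hs ih =>
      have := hstep (m * s⁻¹) (hS ▸ mul_mem hm (inv_mem (Subgroup.subset_closure hs))) s hs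
      rw [inv_mul_cancel_right] at this
      simpa [mul_assoc] using mul_mem ih (inv_mem this)
  have hP₀Q : P₀ ≤ Q := (hP₀P 1).trans le_sup_left
  have hQ' : N ⊓ A ≤ Q := by
    intro x hx
    have hT : t 1 ∈ N ⊓ A := htA 1 (one_mem _)
    -- On `N ⊓ A`, equivariance gives `f m ∈ m * t 1 * P₀`; the conjugation by `t 1` undoes the shift.
    have hm : t 1 * x * (t 1)⁻¹ ∈ N ⊓ A := mul_mem (mul_mem hT hx) (inv_mem hT)
    have h₁ := hfm 1 (one_mem _) _ hm
    have h₂ := hft 1 (one_mem _) 1 (by simpa using hone)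
    rw [mul_one] at h₁
    have h₃ := mul_mem (mul_mem (hP₀Q h₂) (hconst _ hm.1)) (hP₀Q (inv_mem h₁))
    convert h₃ using 1
    group
  rwa [le_antisymm hQ' hQA]

/-! ### Finite generation of the normal subgroup -/

/-- The elements of `N` that carry the edge `g'C` to an edge at the vertex `gH` lie in a finitely
generated subgroup: any two of them differ by the stabilizer of that vertex. -/
theorem exists_fg_transition (N H C : Subgroup G) [N.Normal] (hC : C ≤ H) (hN : (N ⊓ H).FG)
    (g g' : G) : ∃ M ≤ N, M.FG ∧ ∀ w ∈ H, ∀ n ∈ N, ∀ c ∈ C, g * w = n * g' * c → n ∈ M := by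
  by_cases hex : ∃ w ∈ H, ∃ n ∈ N, ∃ c ∈ C, g * w = n * g' * c
  · obtain ⟨w₀, hw₀, n₀, hn₀, c₀, hc₀, e₀⟩ := hex
    refine ⟨(N ⊓ H).map (MulAut.conj g).toMonoidHom ⊔ Subgroup.zpowers n₀, sup_le ?_ ?_,
      (hN.map_hom _).sup (Subgroup.fg_zpowers _), ?_⟩
    · rintro _ ⟨x, hx, rfl⟩
      exact ‹N.Normal›.conj_mem x hx.1 g
    · rwa [Subgroup.zpowers_le]
    · intro w hw n hn c hc e
      have hx : n * n₀⁻¹ = g * (w * c⁻¹ * (w₀ * c₀⁻¹)⁻¹) * g⁻¹ := by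
        have h₁ : n = g * w * c⁻¹ * g'⁻¹ := by rw [e]; group
        have h₂ : n₀ = g * w₀ * c₀⁻¹ * g'⁻¹ := by rw [e₀]; group
        rw [h₁, h₂]
        group
      have hxN : w * c⁻¹ * (w₀ * c₀⁻¹)⁻¹ ∈ N := by
        have := ‹N.Normal›.conj_mem _ (mul_mem hn (inv_mem hn₀)) g⁻¹
        rw [hx] at this
        convert this using 1
        group
      have hxH : w * c⁻¹ * (w₀ * c₀⁻¹)⁻¹ ∈ H :=
        mul_mem (mul_mem hw (inv_mem (hC hc))) (inv_mem (mul_mem hw₀ (inv_mem (hC hc₀))))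
      have hmem : n * n₀⁻¹ ∈ (N ⊓ H).map (MulAut.conj g).toMonoidHom :=
        ⟨_, ⟨hxN, hxH⟩, hx.symm⟩
      have := mul_mem (Subgroup.mem_sup_left hmem)
        (Subgroup.mem_sup_right (Subgroup.mem_zpowers n₀))
      rwa [inv_mul_cancel_right] at this
  · refine ⟨⊥, bot_le, ⟨∅, by simp⟩, fun w hw n hn c hc e => ?_⟩
    exact absurd ⟨w, hw, n, hn, c, hc, e⟩ hex

/-- If `NC` has finite index and `N ⊓ A` and `N ⊓ B` are finitely generated, then so is `N`. Only
`A ⊔ B = ⊤` is used of the amalgamated product. -/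
theorem Subgroup.fg_of_fg_inf {A B C N : Subgroup G} [N.Normal] (hA : C ≤ A) (hB : C ≤ B)
    (hAB : A ⊔ B = ⊤) [(N ⊔ C).FiniteIndex] (hNA : (N ⊓ A).FG) (hNB : (N ⊓ B).FG) : N.FG := by
  -- Representatives of the cosets of `NC`, together with `1`.
  let r : Option (G ⧸ (N ⊔ C)) → G := fun q => q.elim 1 Quotient.out
  choose MA hMA hMAfg hMA' using fun q : Option (G ⧸ (N ⊔ C)) × Option (G ⧸ (N ⊔ C)) =>
    exists_fg_transition N A C hA hNA (r q.1) (r q.2)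
  choose MB hMB hMBfg hMB' using fun q : Option (G ⧸ (N ⊔ C)) × Option (G ⧸ (N ⊔ C)) =>
    exists_fg_transition N B C hB hNB (r q.1) (r q.2)
  let M : Subgroup G := (⨆ q, MA q) ⊔ ⨆ q, MB q
  have hM : M.FG := (Subgroup.FG.iSup _ hMAfg).sup (Subgroup.FG.iSup _ hMBfg)
  have hMN : M ≤ N := sup_le (iSup_le hMA) (iSup_le hMB)
  have hstepA : ∀ i j, ∀ w ∈ A, ∀ n ∈ N, ∀ c ∈ C, r i * w = n * r j * c → n ∈ M :=
    fun i j w hw n hn c hc e =>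
      Subgroup.mem_sup_left (Subgroup.mem_iSup_of_mem (i, j) (hMA' (i, j) w hw n hn c hc e))
  have hstepB : ∀ i j, ∀ w ∈ B, ∀ n ∈ N, ∀ c ∈ C, r i * w = n * r j * c → n ∈ M :=
    fun i j w hw n hn c hc e =>
      Subgroup.mem_sup_right (Subgroup.mem_iSup_of_mem (i, j) (hMB' (i, j) w hw n hn c hc e))
  have hrep : ∀ g, ∃ j, ∃ n ∈ N, ∃ c ∈ C, g = n * r j * c := by
    intro g
    have h₁ : (g : G ⧸ (N ⊔ C)).out⁻¹ * g ∈ N ⊔ C := by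
      rw [← QuotientGroup.eq]
      exact Quotient.out_eq _
    obtain ⟨y, hy, z, hz, e⟩ := Subgroup.mem_sup_of_normal_left.1 h₁
    refine ⟨some g, _, ‹N.Normal›.conj_mem y hy (g : G ⧸ (N ⊔ C)).out, z, hz, ?_⟩
    change g = _ * (g : G ⧸ (N ⊔ C)).out * z
    rw [inv_mul_cancel_right, mul_assoc, e, mul_inv_cancel_left]
  -- The edges in `⋃ j, M (r j) C` contain `C` and are closed under adjacency, so they are all edges.
  have hcover : ∀ g, ∃ j, ∃ m ∈ M, ∃ c ∈ C, g = m * r j * c := by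
    intro g
    have hg : g ∈ Subgroup.closure ((A : Set G) ∪ B) := by
      rw [← Subgroup.sup_eq_closure, hAB]
      trivial
    have hmul : ∀ x y, (∃ j, ∃ m ∈ M, ∃ c ∈ C, x = m * r j * c) → (y ∈ A ∨ y ∈ B) →
        ∃ j, ∃ m ∈ M, ∃ c ∈ C, x * y = m * r j * c := by
      rintro x y ⟨i, m, hm, c, hc, rfl⟩ hy
      obtain ⟨j, n, hn, c', hc', e⟩ := hrep (r i * (c * y))
      have hnM : n ∈ M := hy.elim
        (fun hy => hstepA i j _ (mul_mem (hA hc) hy) n hn c' hc' e)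
        (fun hy => hstepB i j _ (mul_mem (hB hc) hy) n hn c' hc' e)
      refine ⟨j, m * n, mul_mem hm hnM, c', hc', ?_⟩
      rw [mul_assoc, mul_assoc, e]
      group
    induction hg using Subgroup.closure_induction_right with
    | one => exact ⟨none, 1, one_mem _, 1, one_mem _, by simp [r]⟩
    | mul_right x _ y hy ih => exact hmul x y ih hy
    | mul_inv_cancel x _ y hy ih => exact hmul x y⁻¹ ih (hy.imp inv_mem inv_mem)
  have hNM : N ≤ M := by
    intro n hn
    obtain ⟨j, m, hm, c, hc, e⟩ := hcover n
    have h₁ : m⁻¹ * n ∈ M :=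
      hstepA j none c (hA hc) _ (mul_mem (inv_mem (hMN hm)) hn) 1 (one_mem _) <| by
        rw [e]
        simp [r, mul_assoc]
    simpa using mul_mem hm h₁
  rwa [le_antisymm hNM hMN]

theorem Subgroup.finite_quotient_iff_of_finiteIndex_sup (N C : Subgroup G) [N.Normal]
    [h : (N ⊔ C).FiniteIndex] : Finite (G ⧸ N) ↔ Finite (C ⧸ N.subgroupOf C) := by
  rw [← Subgroup.finiteIndex_iff_finite_quotient, ← Subgroup.finiteIndex_iff_finite_quotient,
    Subgroup.finiteIndex_iff, Subgroup.finiteIndex_iff,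
    ← Subgroup.relIndex_mul_index (le_sup_left : N ≤ N ⊔ C), Subgroup.relIndex_sup_left]
  exact mul_ne_zero_iff_right h.index_ne_zero

end

theorem theorem2p1 {G : Type*} [Group G] (A B C : Subgroup G)
    (hG : IsNontrivialAmalgamatedProduct A B C) (N : Subgroup G) [N.Normal] :
    (N.FG → ¬ N ≤ C →
      (N ⊔ C).FiniteIndex ∧ ((N ⊓ C).FG → (N ⊓ A).FG ∧ (N ⊓ B).FG)) ∧
    ((N ⊔ C).FiniteIndex →
      ¬ N ≤ C ∧ ((N ⊓ A).FG → (N ⊓ B).FG → N.FG)) ∧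
    ((N ⊔ C).FiniteIndex → (Finite (G ⧸ N) ↔ Finite (C ⧸ N.subgroupOf C))) := by
  obtain ⟨U, hU⟩ := hG.exists_isHalfTree
  refine ⟨fun hN hNC => ?_, fun hfin => ⟨fun hNC => ?_, ?_⟩, fun hfin => ?_⟩
  · have hfin := hU.finiteIndex_sup hG.left_ne hG.ne_right hN hNC
    exact ⟨hfin, fun hC => ⟨hU.fg_inf_left hN hC, hU.compl.fg_inf_left hN hC⟩⟩
  · rw [sup_eq_right.2 hNC] at hfin
    exact hU.not_finiteIndex hG.left_ne hG.ne_right hfin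
  · exact Subgroup.fg_of_fg_inf hU.le_left hU.le_right hU.sup_eq_top
  · exact Subgroup.finite_quotient_iff_of_finiteIndex_sup N C
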